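/- Let $H$ be a finite (simple, undirected) pattern graph that contains a 4-clique. In $H$-detection the nodes of a network $G$ have to decide whether $G$ has a subgraph isomorphic to $H$, and in induced $H$-detection whether $G$ has an induced subgraph isomorphic to $H$. Consider the $\mathsf{CONGEST}$ model on connected $n$-node networks: the nodes have distinct identifiers $0,\dots,n-1$, each node initially knows $n$, its own identifier, the identifiers of its neighbours and its random coins (private or shared), local computation is free, and in each synchronous round every node may send a message of at most $B(n)=O(\log n)$ bits to each neighbour, with different messages to different neighbours allowed. A (randomized) algorithm solves a decision problem in $T$ rounds if on every connected $n$-node network, with probability at least $2/3$, after $T$ rounds at least one node outputs "yes" if the answer is yes, and no node outputs "yes" if the answer is no; deterministic algorithms are a special case. Then any $\mathsf{CONGEST}$ algorithm that solves either $H$-detection or induced $H$-detection needs $\Omega(n^{1/2}/\log n)$ rounds. That is, for every real $b$ there are $c>0$ and $n_0$, depending only on $H$ and $b$, such that for every $n\ge n_0$, every algorithm with messages of at most $B\le b\log n$ bits that solves $H$-detection or induced $H$-detection on connected $n$-node networks in $T$ rounds satisfies $T\ge c\,n^{1/2}/\log n$. -/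

import Mathlib

open MeasureTheory

namespace Congest

/-- A message of at most `B` bits (the empty message is allowed). -/
abbrev Message (B : ℕ) : Type := {l : List Bool // l.length ≤ B}

/-- A (randomized) algorithm in the `CONGEST` model with bandwidth `B` for networks on `n` nodes.

The nodes carry the distinct identifiers `0, …, n - 1`, and are named by them. All nodes run the
same code, know `n` and `B`, and have unbounded local computation. At the start a node knows its own
identifier, the identifiers of its neighbours and its random seed. In every round, a node sends to
each of its neighbours a message of at most `B` bits (possibly different ones to different
neighbours), and then updates its state from the messages that it has received.

`law` is the joint law of the seeds of all nodes. Private coins are the case of a product measure,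
shared coins the case of a law on the diagonal, and deterministic algorithms the case `Seed = Unit`. -/
structure Algorithm (n B : ℕ) where
  /-- The random seeds of a node. -/
  Seed : Type
  /-- The measurable space of seeds. -/
  seedSpace : MeasurableSpace Seed
  /-- The joint law of the seeds of all nodes. -/
  law : Measure (Fin n → Seed)
  /-- The joint law is a probability measure. -/
  law_prob : IsProbabilityMeasure law
  /-- The local states of a node. -/
  State : Type
  /-- The state before the first round, from the identifier of the node, the identifiers of its
  neighbours, and its seed. -/
  start : Fin n → Set (Fin n) → Seed → State
  /-- The message that a node in the given state sends to the neighbour with the given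
  identifier. -/
  send : State → Fin n → Message B
  /-- The new state, from the old one and the messages received in this round; the entry of `u` is
  `none` if `u` is not a neighbour. -/
  step : State → (Fin n → Option (Message B)) → State
  /-- The local output: `true` means that the node reports that the property holds. -/
  output : State → Bool

namespace Algorithm

variable {n B : ℕ}

open Classical in
/-- The state of every node after `t` rounds on the network `G`, for given seeds. -/
noncomputable def run (A : Algorithm n B) (G : SimpleGraph (Fin n)) (seed : Fin n → A.Seed) :
    ℕ → Fin n → A.State
  | 0 => fun v => A.start v (G.neighborSet v) (seed v)
  | t + 1 => fun v => A.step (A.run G seed t v)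
      (fun u => if G.Adj u v then some (A.send (A.run G seed t u) v) else none)

/-- After `T` rounds, at least one node outputs `true`. -/
def Accepts (A : Algorithm n B) (G : SimpleGraph (Fin n)) (T : ℕ) (seed : Fin n → A.Seed) : Prop :=
  ∃ v, A.output (A.run G seed T v) = true

/-- `A` decides the graph predicate `P` in `T` rounds: on each connected network `G` on `n` nodes,
with probability at least `2 / 3`, after `T` rounds some node outputs `true` if `G` satisfies `P`,
and no node does if `G` does not satisfy `P`. -/
def DecidesIn (A : Algorithm n B) (P : SimpleGraph (Fin n) → Prop) (T : ℕ) : Prop :=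
  ∀ G : SimpleGraph (Fin n), G.Connected →
    letI := A.seedSpace
    MeasurableSet {seed | A.Accepts G T seed ↔ P G} ∧
      2 / 3 ≤ A.law.real {seed | A.Accepts G T seed ↔ P G}

/-- `A` solves `H`-detection in `T` rounds: does the network have a subgraph isomorphic to `H`? -/
def SolvesDetection (A : Algorithm n B) {W : Type*} (H : SimpleGraph W) (T : ℕ) : Prop :=
  A.DecidesIn (fun G => H.IsContained G) T

/-- `A` solves induced `H`-detection in `T` rounds: does the network have an induced subgraph
isomorphic to `H`? -/
def SolvesInducedDetection (A : Algorithm n B) {W : Type*} (H : SimpleGraph W) (T : ℕ) : Prop :=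
  A.DecidesIn (fun G => H.IsIndContained G) T

end Algorithm

end Congest

namespace Congest

namespace Disjointness

variable {U : Type*} [DecidableEq U]

/-- The exponential moment bound for a family of subsets of `S`: if the average weight of a member is
at most `w`, then the family is small. -/
theorem card_mul_exp_le (S : Finset U) (𝒜 : Finset (Finset U)) (h𝒜 : 𝒜 ⊆ S.powerset)
    (u v : U → ℝ) (w : ℝ)
    (hw : ∑ x ∈ 𝒜, (∑ i ∈ x, u i + ∑ i ∈ S \ x, v i) ≤ 𝒜.card * w) :
    𝒜.card * Real.exp (-w) ≤ ∏ i ∈ S, (Real.exp (-u i) + Real.exp (-v i)) := by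
  have h1 : ∑ x ∈ 𝒜, Real.exp (-w) * (1 + (w - (∑ i ∈ x, u i + ∑ i ∈ S \ x, v i))) ≤
      ∑ x ∈ 𝒜, Real.exp (-(∑ i ∈ x, u i + ∑ i ∈ S \ x, v i)) := by
    refine Finset.sum_le_sum fun x _ => ?_
    have h := Real.add_one_le_exp (w - (∑ i ∈ x, u i + ∑ i ∈ S \ x, v i))
    calc _ ≤ Real.exp (-w) * Real.exp (w - (∑ i ∈ x, u i + ∑ i ∈ S \ x, v i)) := by
            gcongr; linarith
      _ = _ := by rw [← Real.exp_add]; congr 1; ring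
  have h2 : (𝒜.card : ℝ) * Real.exp (-w) ≤
      ∑ x ∈ 𝒜, Real.exp (-w) * (1 + (w - (∑ i ∈ x, u i + ∑ i ∈ S \ x, v i))) := by
    rw [← Finset.mul_sum, Finset.sum_add_distrib, Finset.sum_sub_distrib, mul_comm]
    simp only [Finset.sum_const, nsmul_eq_mul, mul_one]
    gcongr
    linarith
  refine h2.trans (h1.trans ?_)
  rw [Finset.prod_add]
  refine (Finset.sum_le_sum_of_subset_of_nonneg h𝒜 fun _ _ _ => (Real.exp_pos _).le).trans
    (Finset.sum_le_sum fun x _ => ?_)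
  rw [← Real.exp_sum, ← Real.exp_sum, ← Real.exp_add, Finset.sum_neg_distrib,
    Finset.sum_neg_distrib]
  apply Real.exp_le_exp.2
  linarith

theorem one_add_exp_le : 1 + Real.exp (-(1 / 5 : ℝ)) ≤ 2 * Real.exp (-(19 / 200 : ℝ)) := by
  have h := Real.cosh_le_exp_half_sq (1 / 10)
  rw [Real.cosh_eq] at h
  have h2 : Real.exp (-(1 / 10 : ℝ)) * (Real.exp (1 / 10) + Real.exp (-(1 / 10 : ℝ))) =
      1 + Real.exp (-(1 / 5 : ℝ)) := by
    rw [mul_add, ← Real.exp_add, ← Real.exp_add]; norm_num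
  have h3 : Real.exp (-(1 / 10 : ℝ)) * Real.exp ((1 / 10) ^ 2 / 2) =
      Real.exp (-(19 / 200 : ℝ)) := by
    rw [← Real.exp_add]; norm_num
  rw [← h2, ← h3]
  nlinarith [Real.exp_pos (-(1 / 10 : ℝ))]

theorem prod_ite_le {S J : Finset U} (hJ : J ⊆ S) :
    ∏ i ∈ S, (1 + Real.exp (-(if i ∈ J then (1 / 5 : ℝ) else 0))) ≤
      2 ^ S.card * Real.exp (-(19 / 200 : ℝ) * J.card) := by
  calc _ ≤ ∏ i ∈ S, (2 * if i ∈ J then Real.exp (-(19 / 200 : ℝ)) else 1) := by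
        refine Finset.prod_le_prod (fun _ _ => by positivity) fun i _ => ?_
        split_ifs
        · exact one_add_exp_le
        · norm_num
    _ = _ := by
        rw [Finset.prod_mul_distrib, Finset.prod_const, Finset.prod_ite_mem,
          Finset.inter_eq_right.2 hJ, Finset.prod_const, ← Real.exp_nat_mul]
        ring_nf

/-- A family of subsets of `S` whose members contain each point of `J` too rarely is small. -/
theorem card_le_of_rare {S J : Finset U} (hJ : J ⊆ S) {𝒜 : Finset (Finset U)}
    (h𝒜 : 𝒜 ⊆ S.powerset)
    (h : ∀ i ∈ J, ((𝒜.filter (i ∈ ·)).card : ℝ) ≤ 9 / 20 * 𝒜.card) :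
    (𝒜.card : ℝ) ≤ 2 ^ S.card * Real.exp (-(J.card / 200 : ℝ)) := by
  have key := card_mul_exp_le S 𝒜 h𝒜 (fun i => if i ∈ J then (1 / 5 : ℝ) else 0) 0
    (9 / 100 * J.card) (by
      have : ∀ x ∈ 𝒜, (∑ i ∈ x, (if i ∈ J then (1 / 5 : ℝ) else 0)) + ∑ i ∈ S \ x, (0 : U → ℝ) i =
          ∑ i ∈ J, if i ∈ x then (1 / 5 : ℝ) else 0 := by
        intro x _
        simp [Finset.sum_ite_mem, Finset.inter_comm]
      rw [Finset.sum_congr rfl this, Finset.sum_comm]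
      calc _ ≤ ∑ i ∈ J, (1 / 5 : ℝ) * (9 / 20 * 𝒜.card) := by
            refine Finset.sum_le_sum fun i hi => ?_
            rw [← Finset.sum_filter, Finset.sum_const, nsmul_eq_mul]
            linarith [h i hi]
        _ = _ := by simp; ring)
  have h2 : (𝒜.card : ℝ) * Real.exp (-(9 / 100 * J.card)) ≤
      2 ^ S.card * Real.exp (-(19 / 200 : ℝ) * J.card) := by
    refine key.trans (le_trans (le_of_eq ?_) (prod_ite_le hJ))
    refine Finset.prod_congr rfl fun i _ => ?_
    simp [add_comm]
  rw [← mul_le_mul_iff_left₀ (Real.exp_pos (-(9 / 100 * J.card : ℝ)))]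
  refine h2.trans (le_of_eq ?_)
  rw [mul_assoc, ← Real.exp_add]
  ring_nf

/-- A family of subsets of `S` whose members avoid each point of `J` too rarely is small. -/
theorem card_le_of_frequent {S J : Finset U} (hJ : J ⊆ S) {𝒜 : Finset (Finset U)}
    (h𝒜 : 𝒜 ⊆ S.powerset)
    (h : ∀ i ∈ J, ((𝒜.filter (i ∉ ·)).card : ℝ) ≤ 9 / 20 * 𝒜.card) :
    (𝒜.card : ℝ) ≤ 2 ^ S.card * Real.exp (-(J.card / 200 : ℝ)) := by
  have hinj : Set.InjOn (S \ ·) (𝒜 : Set (Finset U)) := by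
    intro x hx y hy hxy
    have hx' := Finset.mem_powerset.1 (h𝒜 hx)
    have hy' := Finset.mem_powerset.1 (h𝒜 hy)
    rw [← Finset.sdiff_sdiff_eq_self hx', ← Finset.sdiff_sdiff_eq_self hy']
    exact congrArg (S \ ·) hxy
  have hc := Finset.card_image_of_injOn hinj
  rw [← hc]
  refine card_le_of_rare hJ (fun x hx => ?_) fun i hi => ?_
  · obtain ⟨y, _, rfl⟩ := Finset.mem_image.1 hx
    exact Finset.mem_powerset.2 Finset.sdiff_subset
  · rw [hc]
    refine le_trans ?_ (h i hi)
    rw [Finset.filter_image]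
    refine Nat.cast_le.2 (Finset.card_image_le.trans (Finset.card_le_card fun x hx => ?_))
    rw [Finset.mem_filter] at hx ⊢
    exact ⟨hx.1, (Finset.mem_sdiff.1 hx.2).2⟩

/-- The number of members of `𝒜` that are subsets of `R`. -/
def countIn (𝒜 : Finset (Finset U)) (R : Finset U) : ℕ := (𝒜.filter (· ⊆ R)).card

/-- The number of subsets of `R` which become members of `𝒜` when `i` is added. -/
def countWith (𝒜 : Finset (Finset U)) (R : Finset U) (i : U) : ℕ :=
  (R.powerset.filter (insert i · ∈ 𝒜)).card

theorem countIn_le (𝒜 : Finset (Finset U)) (R : Finset U) : countIn 𝒜 R ≤ 2 ^ R.card := by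
  rw [countIn, ← Finset.card_powerset]
  refine Finset.card_le_card fun x hx => Finset.mem_powerset.2 (Finset.mem_filter.1 hx).2

theorem card_filter_mem (𝒜 : Finset (Finset U)) {S : Finset U} {i : U} (hi : i ∈ S) :
    ((𝒜.filter (· ⊆ S)).filter (i ∈ ·)).card = countWith 𝒜 (S.erase i) i := by
  symm
  refine Finset.card_bij (fun x _ => insert i x) ?_ ?_ ?_
  · intro x hx
    simp only [Finset.mem_filter, Finset.mem_powerset] at hx ⊢
    refine ⟨⟨hx.2, Finset.insert_subset hi (hx.1.trans (Finset.erase_subset _ _))⟩, by simp⟩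
  · intro x hx y hy hxy
    simp only [Finset.mem_filter, Finset.mem_powerset, Finset.subset_erase] at hx hy
    rw [← Finset.erase_insert hx.1.2, ← Finset.erase_insert hy.1.2, hxy]
  · intro x hx
    simp only [Finset.mem_filter] at hx
    refine ⟨x.erase i, ?_, Finset.insert_erase hx.2⟩
    simp only [Finset.mem_filter, Finset.mem_powerset, Finset.insert_erase hx.2]
    exact ⟨Finset.erase_subset_erase _ hx.1.2, hx.1.1⟩

theorem card_filter_not_mem (𝒜 : Finset (Finset U)) {S : Finset U} {i : U} :
    ((𝒜.filter (· ⊆ S)).filter (i ∉ ·)).card = countIn 𝒜 (S.erase i) := by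
  rw [Finset.filter_filter, countIn]
  simp only [Finset.subset_erase]

theorem countIn_erase_add (𝒜 : Finset (Finset U)) {S : Finset U} {i : U} (hi : i ∈ S) :
    countWith 𝒜 (S.erase i) i + countIn 𝒜 (S.erase i) = countIn 𝒜 S := by
  rw [← card_filter_mem 𝒜 hi, ← card_filter_not_mem, Finset.card_filter_add_card_filter_not,
    countIn]

theorem countIn_eq_sum (𝒜 : Finset (Finset U)) (R : Finset U) :
    (countIn 𝒜 R : ℝ) = ∑ x ∈ R.powerset, if x ∈ 𝒜 then (1 : ℝ) else 0 := by
  rw [Finset.sum_boole, countIn]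
  congr 2
  ext x
  simp [and_comm]

theorem countWith_eq_sum (𝒜 : Finset (Finset U)) (R : Finset U) (i : U) :
    (countWith 𝒜 R i : ℝ) = ∑ x ∈ R.powerset, if insert i x ∈ 𝒜 then (1 : ℝ) else 0 := by
  rw [Finset.sum_boole, countWith]

/-- The weight of the points which are contained too rarely in the members of `𝒜`. -/
theorem sum_rare_le (𝒜 : Finset (Finset U)) (S : Finset U) :
    ∑ i ∈ S with (11 * countWith 𝒜 (S.erase i) i < 9 * countIn 𝒜 (S.erase i)),
        (countIn 𝒜 (S.erase i) : ℝ) ≤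
      20 / 441 * ∑ i ∈ S, (countIn 𝒜 (S.erase i) : ℝ) +
        S.card * (2 ^ S.card * Real.exp (-(S.card / 10000 : ℝ))) := by
  set a : ℝ := ((countIn 𝒜 S : ℕ) : ℝ) with ha
  set η : ℝ := 2 ^ S.card * Real.exp (-(S.card / 10000 : ℝ)) with hη
  have hη0 : 0 ≤ η := by positivity
  have hsum : ∀ i ∈ S, (countWith 𝒜 (S.erase i) i : ℝ) + countIn 𝒜 (S.erase i) = a :=
    fun i hi => by rw [ha, ← countIn_erase_add 𝒜 hi]; push_cast; ring
  have hle : ∀ i ∈ S, (countIn 𝒜 (S.erase i) : ℝ) ≤ a := fun i hi => by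
    have := hsum i hi
    have h0 : (0 : ℝ) ≤ countWith 𝒜 (S.erase i) i := Nat.cast_nonneg _
    linarith
  set J := S.filter fun i => 11 * countWith 𝒜 (S.erase i) i < 9 * countIn 𝒜 (S.erase i) with hJ
  have hJS : J ⊆ S := Finset.filter_subset _ _
  have hbad : ∑ i ∈ J, (countIn 𝒜 (S.erase i) : ℝ) ≤ J.card * a := by
    rw [← nsmul_eq_mul]
    exact Finset.sum_le_card_nsmul _ _ _ fun i hi => hle i (hJS hi)
  have ha0 : 0 ≤ a := Nat.cast_nonneg _
  have hnn : 0 ≤ ∑ i ∈ S, (countIn 𝒜 (S.erase i) : ℝ) :=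
    Finset.sum_nonneg fun _ _ => Nat.cast_nonneg _
  rcases le_or_gt a η with hsmall | hbig
  · have : (J.card : ℝ) * a ≤ S.card * η :=
      mul_le_mul (Nat.cast_le.2 (Finset.card_le_card hJS)) hsmall ha0 (Nat.cast_nonneg _)
    linarith
  · have hsub : 𝒜.filter (· ⊆ S) ⊆ S.powerset := fun x hx =>
      Finset.mem_powerset.2 (Finset.mem_filter.1 hx).2
    have few : ∀ I : Finset U, a ≤ 2 ^ S.card * Real.exp (-(I.card / 200 : ℝ)) →
        (I.card : ℝ) ≤ S.card / 50 := by
      intro I hI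
      by_contra! hlt
      have : (2 : ℝ) ^ S.card * Real.exp (-(I.card / 200 : ℝ)) ≤ η := by
        exact mul_le_mul_of_nonneg_left (Real.exp_le_exp.2 (by linarith)) (by positivity)
      linarith
    have hJ1 := few J (card_le_of_rare hJS hsub fun i hi => by
      rw [card_filter_mem 𝒜 (hJS hi)]
      have h1 := hsum i (hJS hi)
      have h2 : (11 * countWith 𝒜 (S.erase i) i : ℝ) < 9 * countIn 𝒜 (S.erase i) := by
        exact_mod_cast (Finset.mem_filter.1 hi).2
      change _ ≤ 9 / 20 * a
      linarith)
    set I := S.filter fun i => (countIn 𝒜 (S.erase i) : ℝ) ≤ 9 / 20 * a with hI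
    have hI1 := few I (card_le_of_frequent (Finset.filter_subset _ _) hsub fun i hi => by
      rw [card_filter_not_mem 𝒜]
      exact (Finset.mem_filter.1 hi).2)
    have hge : ((S.card : ℝ) - I.card) * (9 / 20 * a) ≤
        ∑ i ∈ S, (countIn 𝒜 (S.erase i) : ℝ) := by
      have h1 : ((S \ I).card : ℝ) = S.card - I.card := by
        rw [Finset.card_sdiff_of_subset (Finset.filter_subset _ _),
          Nat.cast_sub (Finset.card_le_card (Finset.filter_subset _ _))]
      rw [← h1, ← nsmul_eq_mul]
      refine (Finset.card_nsmul_le_sum _ _ _ fun i hi => ?_).trans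
        (Finset.sum_le_sum_of_subset_of_nonneg Finset.sdiff_subset fun _ _ _ => Nat.cast_nonneg _)
      simp only [hI, Finset.mem_sdiff, Finset.mem_filter, not_and, not_le] at hi
      exact (hi.2 hi.1).le
    have h3 : (S.card : ℝ) * (49 / 50) * (9 / 20 * a) ≤ ((S.card : ℝ) - I.card) * (9 / 20 * a) := by
      gcongr; linarith
    have h4 : (J.card : ℝ) * a ≤ S.card / 50 * a := by gcongr
    have h5 : 0 ≤ (S.card : ℝ) * η := by positivity
    nlinarith

end Disjointness

namespace Disjointness

variable {U : Type*} [Fintype U] [DecidableEq U]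

/-- The pairs of a set of `m + 1` points and one of its points. -/
def pointed (U : Type*) [Fintype U] [DecidableEq U] (m : ℕ) :
    Finset ((_ : Finset U) × U) :=
  (Finset.powersetCard (m + 1) Finset.univ).sigma id

theorem mem_pointed {m : ℕ} {p : (_ : Finset U) × U} :
    p ∈ pointed U m ↔ p.1.card = m + 1 ∧ p.2 ∈ p.1 := by
  simp [pointed, Finset.mem_powersetCard]

theorem sum_pointed_symm {m : ℕ} (hU : Fintype.card U = 2 * m + 1) (f : Finset U → U → ℝ) :
    ∑ p ∈ pointed U m, f (insert p.2 p.1ᶜ) p.2 = ∑ p ∈ pointed U m, f p.1 p.2 := by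
  have hmem : ∀ p ∈ pointed U m, (⟨insert p.2 p.1ᶜ, p.2⟩ : (_ : Finset U) × U) ∈ pointed U m := by
    intro p hp
    rw [mem_pointed] at hp ⊢
    refine ⟨?_, Finset.mem_insert_self _ _⟩
    rw [Finset.card_insert_of_notMem (by simpa using hp.2), Finset.card_compl, hU, hp.1]
    omega
  have hinv : ∀ p ∈ pointed U m,
      (⟨insert p.2 (insert p.2 p.1ᶜ)ᶜ, p.2⟩ : (_ : Finset U) × U) = p := by
    rintro ⟨S, i⟩ hp
    rw [mem_pointed] at hp
    simp [Finset.compl_insert, Finset.insert_erase hp.2]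
  exact Finset.sum_nbij' (fun p => ⟨insert p.2 p.1ᶜ, p.2⟩) (fun p => ⟨insert p.2 p.1ᶜ, p.2⟩)
    hmem hmem hinv hinv fun _ _ => rfl

theorem sum_rare_mul_le {m : ℕ} (hU : Fintype.card U = 2 * m + 1) (𝒜 ℬ : Finset (Finset U)) :
    ∑ p ∈ pointed U m,
        (if 11 * countWith 𝒜 (p.1.erase p.2) p.2 < 9 * countIn 𝒜 (p.1.erase p.2) then
          (countIn 𝒜 (p.1.erase p.2) : ℝ) * countIn ℬ p.1ᶜ else 0) ≤
      20 / 441 * ∑ p ∈ pointed U m, (countIn 𝒜 (p.1.erase p.2) : ℝ) * countIn ℬ p.1ᶜ +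
        2 * Real.exp (-((m + 1 : ℝ) / 10000)) * ((pointed U m).card * 4 ^ m) := by
  rw [pointed, Finset.sum_sigma, Finset.sum_sigma, Finset.card_sigma, Finset.mul_sum]
  push_cast
  rw [Finset.sum_mul, Finset.mul_sum, ← Finset.sum_add_distrib]
  refine Finset.sum_le_sum fun S hS => ?_
  have hS := (Finset.mem_powersetCard.1 hS).2
  have hc : (countIn ℬ Sᶜ : ℝ) ≤ 2 ^ m := by
    have h := countIn_le ℬ Sᶜ
    rw [Finset.card_compl, hU, hS, show 2 * m + 1 - (m + 1) = m by omega] at h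
    exact_mod_cast h
  have h := mul_le_mul_of_nonneg_right (sum_rare_le 𝒜 S)
    (Nat.cast_nonneg (α := ℝ) (countIn ℬ Sᶜ))
  rw [Finset.sum_filter, Finset.sum_mul, add_mul, mul_assoc (20 / 441 : ℝ), Finset.sum_mul] at h
  simp only [ite_mul, zero_mul] at h
  refine h.trans ?_
  simp only [id]
  refine add_le_add le_rfl ?_
  rw [hS]
  calc ((m + 1 : ℕ) : ℝ) * (2 ^ (m + 1) * Real.exp (-(((m + 1 : ℕ) : ℝ) / 10000))) *
        countIn ℬ Sᶜ
      ≤ ((m + 1 : ℕ) : ℝ) * (2 ^ (m + 1) * Real.exp (-(((m + 1 : ℕ) : ℝ) / 10000))) * 2 ^ m := by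
        gcongr
    _ = _ := by
        rw [show (4 : ℝ) = 2 * 2 by norm_num, mul_pow]; push_cast; ring

theorem erase_insert_compl {m : ℕ} {p : (_ : Finset U) × U} (hp : p ∈ pointed U m) :
    (insert p.2 p.1ᶜ).erase p.2 = p.1ᶜ :=
  Finset.erase_insert (by simpa using (mem_pointed.1 hp).2)

theorem compl_insert_compl (p : (_ : Finset U) × U) : (insert p.2 p.1ᶜ)ᶜ = p.1.erase p.2 := by
  simp [Finset.compl_insert]

/-- Razborov's corruption bound: a rectangle contains not much less intersecting than disjoint
pairs, up to an exponentially small error. -/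
theorem corruption {m : ℕ} (hU : Fintype.card U = 2 * m + 1) (𝒜 ℬ : Finset (Finset U)) :
    3 / 5 * ∑ p ∈ pointed U m, (countIn 𝒜 (p.1.erase p.2) : ℝ) * countIn ℬ p.1ᶜ ≤
      ∑ p ∈ pointed U m, (countWith 𝒜 (p.1.erase p.2) p.2 : ℝ) * countWith ℬ p.1ᶜ p.2 +
        4 * Real.exp (-((m + 1 : ℝ) / 10000)) * ((pointed U m).card * 4 ^ m) := by
  have hA := sum_rare_mul_le hU 𝒜 ℬ
  have hB := sum_rare_mul_le hU ℬ 𝒜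
  rw [← sum_pointed_symm hU fun S i =>
      if 11 * countWith ℬ (S.erase i) i < 9 * countIn ℬ (S.erase i) then
          (countIn ℬ (S.erase i) : ℝ) * countIn 𝒜 Sᶜ else 0,
    ← sum_pointed_symm hU fun S i => (countIn ℬ (S.erase i) : ℝ) * countIn 𝒜 Sᶜ] at hB
  have e1 : ∀ p ∈ pointed U m,
      (countIn ℬ ((insert p.2 p.1ᶜ).erase p.2) : ℝ) * countIn 𝒜 (insert p.2 p.1ᶜ)ᶜ =
        (countIn 𝒜 (p.1.erase p.2) : ℝ) * countIn ℬ p.1ᶜ := fun p hp => by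
    rw [erase_insert_compl hp, compl_insert_compl, mul_comm]
  have e2 : ∀ p ∈ pointed U m,
      (if 11 * countWith ℬ ((insert p.2 p.1ᶜ).erase p.2) p.2 <
          9 * countIn ℬ ((insert p.2 p.1ᶜ).erase p.2) then
        (countIn ℬ ((insert p.2 p.1ᶜ).erase p.2) : ℝ) * countIn 𝒜 (insert p.2 p.1ᶜ)ᶜ else 0) =
      if 11 * countWith ℬ p.1ᶜ p.2 < 9 * countIn ℬ p.1ᶜ then
        (countIn 𝒜 (p.1.erase p.2) : ℝ) * countIn ℬ p.1ᶜ else 0 := fun p hp => by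
    rw [e1 p hp, erase_insert_compl hp]
  rw [Finset.sum_congr rfl e1, Finset.sum_congr rfl e2] at hB
  have hpt : ∑ p ∈ pointed U m, (countIn 𝒜 (p.1.erase p.2) : ℝ) * countIn ℬ p.1ᶜ ≤
      121 / 81 * (∑ p ∈ pointed U m,
        (countWith 𝒜 (p.1.erase p.2) p.2 : ℝ) * countWith ℬ p.1ᶜ p.2) +
      (∑ p ∈ pointed U m,
        (if 11 * countWith 𝒜 (p.1.erase p.2) p.2 < 9 * countIn 𝒜 (p.1.erase p.2) then
          (countIn 𝒜 (p.1.erase p.2) : ℝ) * countIn ℬ p.1ᶜ else 0) +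
       ∑ p ∈ pointed U m, if 11 * countWith ℬ p.1ᶜ p.2 < 9 * countIn ℬ p.1ᶜ then
        (countIn 𝒜 (p.1.erase p.2) : ℝ) * countIn ℬ p.1ᶜ else 0) := by
    rw [Finset.mul_sum, ← Finset.sum_add_distrib, ← Finset.sum_add_distrib]
    refine Finset.sum_le_sum fun p _ => ?_
    set a0 := countIn 𝒜 (p.1.erase p.2)
    set b0 := countIn ℬ p.1ᶜ
    set a1 := countWith 𝒜 (p.1.erase p.2) p.2
    set b1 := countWith ℬ p.1ᶜ p.2
    have h0 : (0 : ℝ) ≤ a0 * b0 := by positivity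
    have h1 : (0 : ℝ) ≤ a1 * b1 := by positivity
    by_cases ha : 11 * a1 < 9 * a0
    · rw [if_pos ha]
      split_ifs <;> linarith
    · by_cases hb : 11 * b1 < 9 * b0
      · rw [if_neg ha, if_pos hb]; linarith
      · rw [if_neg ha, if_neg hb]
        have ha' : (9 * a0 : ℝ) ≤ 11 * a1 := by exact_mod_cast not_lt.1 ha
        have hb' : (9 * b0 : ℝ) ≤ 11 * b1 := by exact_mod_cast not_lt.1 hb
        have := mul_le_mul ha' hb' (by positivity) (by positivity)
        linarith
  have h0 : 0 ≤ ∑ p ∈ pointed U m, (countIn 𝒜 (p.1.erase p.2) : ℝ) * countIn ℬ p.1ᶜ :=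
    Finset.sum_nonneg fun _ _ => by positivity
  have h1 : 0 ≤ Real.exp (-((m + 1 : ℝ) / 10000)) * (((pointed U m).card : ℝ) * 4 ^ m) := by
    positivity
  linarith

/-- The subsets of two disjoint sets which cover everything but one point. -/
def inputs (m : ℕ) (U : Type*) [Fintype U] [DecidableEq U] :
    Finset ((_ : (_ : Finset U) × U) × Finset U × Finset U) :=
  (pointed U m).sigma fun p => (p.1.erase p.2).powerset ×ˢ p.1ᶜ.powerset

theorem card_inputs {m : ℕ} (hU : Fintype.card U = 2 * m + 1) :
    (inputs m U).card = (pointed U m).card * 4 ^ m := by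
  rw [inputs, Finset.card_sigma, ← smul_eq_mul, ← Finset.sum_const]
  refine Finset.sum_congr rfl fun p hp => ?_
  rw [mem_pointed] at hp
  rw [Finset.card_product, Finset.card_powerset, Finset.card_powerset, Finset.card_compl,
    Finset.card_erase_of_mem hp.2, hU, hp.1, show 2 * m + 1 - (m + 1) = m by omega,
    show m + 1 - 1 = m by omega, ← mul_pow,
    show 2 * 2 = 4 from rfl]

theorem inputs_nonempty {m : ℕ} (hU : Fintype.card U = 2 * m + 1) : (inputs m U).Nonempty := by
  rw [← Finset.card_pos, card_inputs hU]
  refine Nat.mul_pos (Finset.card_pos.2 ?_) (by positivity)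
  obtain ⟨S, hS⟩ := Finset.powersetCard_nonempty (n := m + 1) (s := (Finset.univ : Finset U)) |>.2
    (by rw [Finset.card_univ, hU]; omega)
  have hc := (Finset.mem_powersetCard.1 hS).2
  obtain ⟨i, hi⟩ := Finset.card_pos.1 (by omega : 0 < S.card)
  exact ⟨⟨S, i⟩, mem_pointed.2 ⟨hc, hi⟩⟩

/-- The corruption bound for a union of rectangles. -/
theorem corruption_of_labelling {m : ℕ} (hU : Fintype.card U = 2 * m + 1)
    (N : Finset U → Finset U → Prop) [∀ x y, Decidable (N x y)]
    {L : Type*} [Fintype L] [DecidableEq L] (τ : Finset U → Finset U → L)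
    (hτ : ∀ x y x' y', N x y → N x' y' → τ x y = τ x' y' → N x y' ∧ τ x y' = τ x y) :
    3 / 5 * ∑ q ∈ inputs m U, (if N q.2.1 q.2.2 then (1 : ℝ) else 0) ≤
      ∑ q ∈ inputs m U, (if N (insert q.1.2 q.2.1) (insert q.1.2 q.2.2) then (1 : ℝ) else 0) +
        Fintype.card L * (4 * Real.exp (-((m + 1 : ℝ) / 10000)) * (inputs m U).card) := by
  classical
  let 𝒜 : L → Finset (Finset U) := fun l => Finset.univ.filter fun x => ∃ y, N x y ∧ τ x y = l
  let ℬ : L → Finset (Finset U) := fun l => Finset.univ.filter fun y => ∃ x, N x y ∧ τ x y = l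
  have hrect : ∀ l x y, (x ∈ 𝒜 l ∧ y ∈ ℬ l) ↔ (N x y ∧ τ x y = l) := by
    intro l x y
    simp only [𝒜, ℬ, Finset.mem_filter, Finset.mem_univ, true_and]
    constructor
    · rintro ⟨⟨y', h1, h2⟩, x', h3, h4⟩
      obtain ⟨h5, h6⟩ := hτ x y' x' y h1 h3 (h2.trans h4.symm)
      exact ⟨h5, h6.trans h2⟩
    · rintro ⟨h1, h2⟩
      exact ⟨⟨y, h1, h2⟩, x, h1, h2⟩
  have hind : ∀ x y, (if N x y then (1 : ℝ) else 0) =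
      ∑ l, (if x ∈ 𝒜 l then (1 : ℝ) else 0) * (if y ∈ ℬ l then 1 else 0) := by
    intro x y
    simp only [mul_ite, mul_one, mul_zero, ← ite_and, and_comm (a := y ∈ _), hrect]
    by_cases h : N x y
    · simp [h]
    · simp [h]
  have h0 : ∑ q ∈ inputs m U, (if N q.2.1 q.2.2 then (1 : ℝ) else 0) =
      ∑ l, ∑ p ∈ pointed U m, (countIn (𝒜 l) (p.1.erase p.2) : ℝ) * countIn (ℬ l) p.1ᶜ := by
    simp only [hind]
    rw [Finset.sum_comm]
    refine Finset.sum_congr rfl fun l _ => ?_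
    rw [inputs, Finset.sum_sigma]
    refine Finset.sum_congr rfl fun p _ => ?_
    rw [Finset.sum_product]
    rw [countIn_eq_sum, countIn_eq_sum, Finset.sum_mul_sum]
  have h1 : ∑ q ∈ inputs m U,
        (if N (insert q.1.2 q.2.1) (insert q.1.2 q.2.2) then (1 : ℝ) else 0) =
      ∑ l, ∑ p ∈ pointed U m,
        (countWith (𝒜 l) (p.1.erase p.2) p.2 : ℝ) * countWith (ℬ l) p.1ᶜ p.2 := by
    simp only [hind]
    rw [Finset.sum_comm]
    refine Finset.sum_congr rfl fun l _ => ?_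
    rw [inputs, Finset.sum_sigma]
    refine Finset.sum_congr rfl fun p _ => ?_
    rw [Finset.sum_product]
    rw [countWith_eq_sum, countWith_eq_sum, Finset.sum_mul_sum]
  rw [h0, h1, Finset.mul_sum, card_inputs hU, ← nsmul_eq_mul, ← Finset.card_univ,
    ← Finset.sum_const, ← Finset.sum_add_distrib]
  push_cast
  exact Finset.sum_le_sum fun l _ => corruption hU (𝒜 l) (ℬ l)

/-- The randomized communication complexity of set disjointness: if for every seed the rejected
pairs are a union of few rectangles, then the error cannot be at most `1 / 3`. -/
theorem card_label_ge {m : ℕ} (hU : Fintype.card U = 2 * m + 1)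
    {Ω : Type*} [MeasurableSpace Ω] (μ : Measure Ω) [IsProbabilityMeasure μ]
    (N : Finset U → Finset U → Set Ω) (hN : ∀ x y, MeasurableSet (N x y))
    (hdisj : ∀ x y, Disjoint x y → 2 / 3 ≤ μ.real (N x y))
    (hint : ∀ x y, ¬ Disjoint x y → μ.real (N x y) ≤ 1 / 3)
    {L : Type*} [Fintype L] (τ : Ω → Finset U → Finset U → L)
    (hτ : ∀ s x y x' y', s ∈ N x y → s ∈ N x' y' → τ s x y = τ s x' y' →
      s ∈ N x y' ∧ τ s x y' = τ s x y) :
    1 / 60 ≤ Fintype.card L * Real.exp (-((m + 1 : ℝ) / 10000)) := by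
  classical
  have hpt : ∀ s : Ω, 3 / 5 * ∑ q ∈ inputs m U, (N q.2.1 q.2.2).indicator (1 : Ω → ℝ) s ≤
      ∑ q ∈ inputs m U, (N (insert q.1.2 q.2.1) (insert q.1.2 q.2.2)).indicator (1 : Ω → ℝ) s +
        Fintype.card L * (4 * Real.exp (-((m + 1 : ℝ) / 10000)) * (inputs m U).card) := by
    intro s
    simp only [Set.indicator_apply, Pi.one_apply]
    exact corruption_of_labelling hU (fun x y => s ∈ N x y) (τ s) (hτ s)
  have hi : ∀ x y, Integrable ((N x y).indicator (1 : Ω → ℝ)) μ := fun x y =>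
    (integrable_const (1 : ℝ)).indicator (hN x y)
  have hmono := integral_mono (μ := μ)
    ((integrable_finsetSum _ fun q _ => hi q.2.1 q.2.2).const_mul (3 / 5 : ℝ))
    ((integrable_finsetSum (inputs m U) fun q _ =>
      hi (insert q.1.2 q.2.1) (insert q.1.2 q.2.2)).add (integrable_const
        (Fintype.card L * (4 * Real.exp (-((m + 1 : ℝ) / 10000)) * (inputs m U).card)))) hpt
  simp only [Pi.add_apply] at hmono
  rw [integral_const_mul, integral_add (integrable_finsetSum _ fun q _ => hi _ _)
    (integrable_const _), integral_finsetSum _ fun q _ => hi _ _,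
    integral_finsetSum _ fun q _ => hi _ _] at hmono
  simp only [integral_indicator_one (hN _ _), integral_const, probReal_univ, one_smul] at hmono
  have hc : (0 : ℝ) < (inputs m U).card := by exact_mod_cast (inputs_nonempty hU).card_pos
  have h0 : (inputs m U).card * (2 / 3 : ℝ) ≤
      ∑ q ∈ inputs m U, μ.real (N q.2.1 q.2.2) := by
    rw [← nsmul_eq_mul]
    refine Finset.card_nsmul_le_sum _ _ _ fun q hq => hdisj _ _ ?_
    simp only [inputs, Finset.mem_sigma, Finset.mem_product, Finset.mem_powerset] at hq
    exact (disjoint_compl_right.mono_left (Finset.erase_subset _ _)).mono hq.2.1 hq.2.2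
  have h1 : ∑ q ∈ inputs m U, μ.real (N (insert q.1.2 q.2.1) (insert q.1.2 q.2.2)) ≤
      (inputs m U).card * (1 / 3 : ℝ) := by
    rw [← nsmul_eq_mul]
    refine Finset.sum_le_card_nsmul _ _ _ fun q _ => hint _ _ ?_
    rw [Finset.not_disjoint_iff]
    exact ⟨q.1.2, Finset.mem_insert_self _ _, Finset.mem_insert_self _ _⟩
  have h2 : (inputs m U).card * (1 / 15 : ℝ) ≤ (inputs m U).card *
      (4 * (Fintype.card L * Real.exp (-((m + 1 : ℝ) / 10000)))) := by linarith
  have := le_of_mul_le_mul_left h2 hc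
  linarith

end Disjointness

theorem card_message_le (B : ℕ) :
    ∃ _ : Fintype (Message B), Fintype.card (Message B) ≤ 2 ^ (B + 1) := by
  let f : Message B → (Σ k : Fin (B + 1), List.Vector Bool k) := fun l =>
    ⟨⟨l.1.length, Nat.lt_succ_of_le l.2⟩, ⟨l.1, rfl⟩⟩
  have hf : Function.Injective f := by
    intro l l' h
    have h2 := congrArg (fun p : (Σ k : Fin (B + 1), List.Vector Bool k) => p.2.1) h
    exact Subtype.ext h2
  refine ⟨Fintype.ofInjective f hf, ?_⟩
  let _ := Fintype.ofInjective f hf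
  refine (Fintype.card_le_of_injective f hf).trans ?_
  rw [Fintype.card_sigma]
  simp only [card_vector, Fintype.card_bool]
  rw [Fin.sum_univ_eq_sum_range (fun k => 2 ^ k)]
  exact (Nat.geomSum_lt (m := 2) (n := B + 1) le_rfl fun k hk => Finset.mem_range.1 hk).le

/-- A family of networks for a two-party simulation: the edges inside the part of Alice depend on her
input only, those inside the part of Bob on his input only, and the edges between the parts are
fixed and, in both directions, enumerated by `E`. -/
structure TwoParty {X Y : Type*} {n : ℕ} (G : X → Y → SimpleGraph (Fin n)) (bob : Fin n → Prop)
    {E : Type*} (src tgt : E → Fin n) : Prop where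
  alice_adj : ∀ u v, ¬ bob u → ¬ bob v → ∀ x y y', (G x y).Adj u v → (G x y').Adj u v
  bob_adj : ∀ u v, bob u → bob v → ∀ x x' y, (G x y).Adj u v → (G x' y).Adj u v
  cut_adj : ∀ u v, ¬ (bob u ↔ bob v) → ∀ x y x' y', (G x y).Adj u v → (G x' y').Adj u v
  cut_cover : ∀ u v, ¬ (bob u ↔ bob v) → ∀ x y, (G x y).Adj u v → ∃ e, src e = u ∧ tgt e = v

namespace Algorithm

variable {n B : ℕ} {X Y : Type*} {E : Type*}

/-- The messages sent over the cut in the first `T` rounds. -/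
noncomputable def transcript (A : Algorithm n B) (G : X → Y → SimpleGraph (Fin n))
    (src tgt : E → Fin n) (T : ℕ) (seed : Fin n → A.Seed) (x : X) (y : Y) :
    Fin T → E → Message B :=
  fun t e => A.send (A.run (G x y) seed t (src e)) (tgt e)

variable {G : X → Y → SimpleGraph (Fin n)} {bob : Fin n → Prop} {src tgt : E → Fin n}

theorem _root_.Congest.TwoParty.alice_iff (h : TwoParty G bob src tgt) {v : Fin n} (hv : ¬ bob v)
    (u : Fin n) (x : X) (y y' : Y) : (G x y).Adj u v ↔ (G x y').Adj u v := by
  by_cases hu : bob u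
  · have hc : ¬ (bob u ↔ bob v) := by tauto
    exact ⟨h.cut_adj u v hc _ _ _ _, h.cut_adj u v hc _ _ _ _⟩
  · exact ⟨h.alice_adj u v hu hv _ _ _, h.alice_adj u v hu hv _ _ _⟩

theorem _root_.Congest.TwoParty.bob_iff (h : TwoParty G bob src tgt) {v : Fin n} (hv : bob v)
    (u : Fin n) (x x' : X) (y : Y) : (G x y).Adj u v ↔ (G x' y).Adj u v := by
  by_cases hu : bob u
  · exact ⟨h.bob_adj u v hu hv _ _ _, h.bob_adj u v hu hv _ _ _⟩
  · have hc : ¬ (bob u ↔ bob v) := by tauto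
    exact ⟨h.cut_adj u v hc _ _ _ _, h.cut_adj u v hc _ _ _ _⟩

/-- If two pairs of inputs have the same transcript, then on the mixed pair the nodes of Alice behave
as for the first pair, and those of Bob as for the second one. -/
theorem run_mixed (A : Algorithm n B) (h : TwoParty G bob src tgt) {T : ℕ}
    {seed : Fin n → A.Seed} {x x' : X} {y y' : Y}
    (hτ : A.transcript G src tgt T seed x y = A.transcript G src tgt T seed x' y') :
    ∀ t ≤ T, (∀ v, ¬ bob v → A.run (G x y') seed t v = A.run (G x y) seed t v) ∧
      ∀ v, bob v → A.run (G x y') seed t v = A.run (G x' y') seed t v := by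
  intro t
  induction t with
  | zero =>
    intro _
    refine ⟨fun v hv => ?_, fun v hv => ?_⟩
    · simp only [run]
      congr 1
      ext u
      rw [SimpleGraph.mem_neighborSet, SimpleGraph.mem_neighborSet, SimpleGraph.adj_comm,
        h.alice_iff hv u x y' y, SimpleGraph.adj_comm]
    · simp only [run]
      congr 1
      ext u
      rw [SimpleGraph.mem_neighborSet, SimpleGraph.mem_neighborSet, SimpleGraph.adj_comm,
        h.bob_iff hv u x x' y', SimpleGraph.adj_comm]
  | succ t ih =>
    intro ht
    obtain ⟨ihA, ihB⟩ := ih (by omega)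
    have hmsg : ∀ e, A.send (A.run (G x y) seed t (src e)) (tgt e) =
        A.send (A.run (G x' y') seed t (src e)) (tgt e) := fun e =>
      congrFun (congrFun hτ ⟨t, by omega⟩) e
    refine ⟨fun v hv => ?_, fun v hv => ?_⟩
    · simp only [run]
      rw [ihA v hv]
      congr 1
      ext1 u
      by_cases hadj : (G x y).Adj u v
      · rw [if_pos hadj, if_pos ((h.alice_iff hv u x y y').1 hadj)]
        by_cases hu : bob u
        · obtain ⟨e, rfl, rfl⟩ := h.cut_cover u v (by tauto) x y hadj
          rw [ihB _ hu, hmsg e]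
        · rw [ihA u hu]
      · rw [if_neg hadj, if_neg (mt (h.alice_iff hv u x y y').2 hadj)]
    · simp only [run]
      rw [ihB v hv]
      congr 1
      ext1 u
      by_cases hadj : (G x' y').Adj u v
      · rw [if_pos hadj, if_pos ((h.bob_iff hv u x x' y').2 hadj)]
        by_cases hu : bob u
        · rw [ihB u hu]
        · obtain ⟨e, rfl, rfl⟩ := h.cut_cover u v (by tauto) x' y' hadj
          rw [ihA _ hu, hmsg e]
      · rw [if_neg hadj, if_neg (mt (h.bob_iff hv u x x' y').1 hadj)]

/-- The rejected pairs of inputs with a given transcript form a rectangle. -/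
theorem transcript_mixed (A : Algorithm n B) (h : TwoParty G bob src tgt) {T : ℕ}
    {seed : Fin n → A.Seed} {x x' : X} {y y' : Y}
    (h1 : ¬ A.Accepts (G x y) T seed) (h2 : ¬ A.Accepts (G x' y') T seed)
    (hτ : A.transcript G src tgt T seed x y = A.transcript G src tgt T seed x' y') :
    ¬ A.Accepts (G x y') T seed ∧
      A.transcript G src tgt T seed x y' = A.transcript G src tgt T seed x y := by
  have hrun := A.run_mixed h hτ
  constructor
  · rintro ⟨v, hv⟩
    by_cases hb : bob v
    · rw [(hrun T le_rfl).2 v hb] at hv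
      exact h2 ⟨v, hv⟩
    · rw [(hrun T le_rfl).1 v hb] at hv
      exact h1 ⟨v, hv⟩
  · funext t e
    obtain ⟨hA, hB⟩ := hrun t t.2.le
    by_cases hb : bob (src e)
    · exact (congrArg (fun s => A.send s (tgt e)) (hB _ hb)).trans
        (congrFun (congrFun hτ t) e).symm
    · exact congrArg (fun s => A.send s (tgt e)) (hA _ hb)

end Algorithm

section Cover

variable {W : Type*} {H : SimpleGraph W}

/-- A family of 4-colorable sets of nodes such that each 4-clique is inside one of them. -/
def CliqueCover (H : SimpleGraph W) (𝒞 : Finset (Set W)) : Prop :=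
  (∀ C ∈ 𝒞, (H.induce C).Colorable 4) ∧
    ∀ s : Finset W, H.IsNClique 4 s → ∃ C ∈ 𝒞, (s : Set W) ⊆ C

theorem exists_cliqueCover [Finite W] (H : SimpleGraph W) : ∃ 𝒞, CliqueCover H 𝒞 := by
  classical
  have := Fintype.ofFinite W
  refine ⟨(Finset.univ.filter fun s : Finset W => H.IsNClique 4 s).image
    (fun s : Finset W => (s : Set W)),
    fun C hC => ?_, fun s hs => ⟨s, ?_, subset_rfl⟩⟩
  · obtain ⟨s, hs, rfl⟩ := Finset.mem_image.1 hC
    have h := (H.induce (s : Set W)).colorable_of_fintype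
    have hc : Fintype.card (s : Set W) = 4 := by
      rw [← (Finset.mem_filter.1 hs).2.card_eq]
      exact Fintype.card_coe s
    rwa [hc] at h
  · exact Finset.mem_image_of_mem (fun s : Finset W => (s : Set W)) (Finset.mem_filter.2 ⟨Finset.mem_univ _, hs⟩)

/-- A member of a clique cover of minimum size. -/
theorem exists_minimum_cliqueCover [Finite W] (hH : ¬ H.CliqueFree 4) :
    ∃ 𝒞, CliqueCover H 𝒞 ∧ (∀ 𝒟, CliqueCover H 𝒟 → 𝒞.card ≤ 𝒟.card) ∧ 𝒞.Nonempty := by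
  obtain ⟨𝒞, h𝒞, hmin⟩ := exists_minimalFor_of_wellFoundedLT (CliqueCover H) Finset.card
    (exists_cliqueCover H)
  refine ⟨𝒞, h𝒞, fun 𝒟 h𝒟 => ?_, ?_⟩
  · rcases le_total 𝒞.card 𝒟.card with h | h
    · exact h
    · exact hmin h𝒟 h
  · simp only [SimpleGraph.CliqueFree, not_forall, not_not] at hH
    obtain ⟨s, hs⟩ := hH
    obtain ⟨C, hC, _⟩ := h𝒞.2 s hs
    exact ⟨C, hC⟩

end Cover

section Network

variable {q : ℕ} [NeZero q]

/-- The elements of the disjointness instance. -/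
abbrev Element (q : ℕ) : Type := (Fin q × Fin q) × (Fin q × Fin q)

/-- The four-partite input graph: the parts `0` and `1` belong to Alice, whose edges between them are
the elements of `x`, the parts `2` and `3` to Bob, whose edges are the elements of `y`. -/
def HalfJoined (x y : Finset (Element q)) : Fin 4 → Fin 4 → Fin q × Fin q → Fin q × Fin q → Prop
  | 0, 1, u, v => (u, v) ∈ x
  | 2, 3, u, v => ((u.1, v.1), (u.2, v.2)) ∈ y
  | 0, 2, u, v => u.1 = v.1
  | 0, 3, u, v => u.2 = v.1
  | 1, 2, u, v => u.1 = v.2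
  | 1, 3, u, v => u.2 = v.2
  | _, _, _, _ => False

/-- The adjacency of the copies of two adjacent nodes of the pattern; only nodes with a colour are
blown up. -/
def Joined (x y : Finset (Element q)) :
    Option (Fin 4) → Fin q × Fin q → Option (Fin 4) → Fin q × Fin q → Prop
  | some c, u, some d, v => HalfJoined x y c d u v ∨ HalfJoined x y d c v u
  | some _, _, none, v => v = 0
  | none, u, some _, _ => u = 0
  | none, u, none, v => u = 0 ∧ v = 0

theorem Joined.symm {x y : Finset (Element q)} {c d : Option (Fin 4)} {u v : Fin q × Fin q}
    (h : Joined x y c u d v) : Joined x y d v c u := by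
  rcases c with _ | c <;> rcases d with _ | d <;> simp only [Joined] at h ⊢ <;> tauto

theorem not_joined_self (x y : Finset (Element q)) (c : Fin 4) (u v : Fin q × Fin q) :
    ¬ Joined x y (some c) u (some c) v := by
  fin_cases c <;> simp [Joined, HalfJoined]

variable {W : Type*}

/-- The nodes of the network: the copies of the nodes of the pattern, one pendant node for each
copy, and the remaining nodes. -/
abbrev Node (W : Type*) (q : ℕ) (R : Type*) := (W × (Fin q × Fin q)) ⊕ ((W × (Fin q × Fin q)) ⊕ R)

/-- The adjacency of the network. The pendant nodes and the remaining nodes make it connected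
without creating triangles. -/
def NodeAdj (H : SimpleGraph W) (col : W → Option (Fin 4)) {R : Type*} (x y : Finset (Element q)) :
    Node W q R → Node W q R → Prop
  | .inl a, .inl b => H.Adj a.1 b.1 ∧ Joined x y (col a.1) a.2 (col b.1) b.2
  | .inl a, .inr (.inl b) => a = b
  | .inr (.inl a), .inl b => a = b
  | .inr (.inl _), .inr (.inr _) => True
  | .inr (.inr _), .inr (.inl _) => True
  | _, _ => False

/-- The network for the inputs `x` and `y`. -/
def network (H : SimpleGraph W) (col : W → Option (Fin 4)) (R : Type*) (x y : Finset (Element q)) :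
    SimpleGraph (Node W q R) where
  Adj := NodeAdj H col x y
  symm := ⟨by
    rintro (a | a | a) (b | b | b) h <;> simp only [NodeAdj] at h ⊢
    · exact ⟨h.1.symm, h.2.symm⟩
    · exact h.symm
    · exact h.symm⟩
  loopless := ⟨by rintro (a | a | a) <;> simp [NodeAdj]⟩

variable {H : SimpleGraph W} {col : W → Option (Fin 4)} {R : Type*} {x y : Finset (Element q)}

theorem network_connected [Nonempty W] [Nonempty R] : (network H col R x y).Connected := by
  obtain ⟨r⟩ := ‹Nonempty R›
  obtain ⟨w⟩ := ‹Nonempty W›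
  have mid : ∀ a, (network H col R x y).Reachable (.inr (.inl a)) (.inr (.inr r)) := fun a =>
    SimpleGraph.Adj.reachable trivial
  refine SimpleGraph.connected_iff_exists_forall_reachable _ |>.2 ⟨.inr (.inr r), fun v =>
    SimpleGraph.Reachable.symm ?_⟩
  rcases v with a | a | s
  · have : (network H col R x y).Adj (.inl a) (.inr (.inl a)) := by simp [network, NodeAdj]
    exact this.reachable.trans (mid a)
  · exact mid a
  · have : (network H col R x y).Adj (.inr (.inr s)) (.inr (.inl (w, 0))) := by
      simp [network, NodeAdj]
    exact this.reachable.trans (mid _)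

/-- All nodes of a triangle are copies of nodes of the pattern. -/
theorem exists_eq_inl_of_triangle {a b c : Node W q R} (hab : (network H col R x y).Adj a b)
    (hac : (network H col R x y).Adj a c) (hbc : (network H col R x y).Adj b c) :
    ∃ p, a = .inl p := by
  rcases a with a | a | a
  · exact ⟨a, rfl⟩
  all_goals
    exfalso
    rcases b with b | b | b <;> rcases c with c | c | c <;>
      simp only [network, NodeAdj] at hab hac hbc
  subst hab hac
  exact H.loopless.irrefl _ hbc.1

/-- The color classes of a clique contain a common element. -/
theorem not_disjoint_of_joined (u : Fin 4 → Fin q × Fin q)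
    (hu : ∀ c d, c ≠ d → Joined x y (some c) (u c) (some d) (u d)) : ¬ Disjoint x y := by
  have h01 := hu 0 1 (by decide)
  have h23 := hu 2 3 (by decide)
  have h02 := hu 0 2 (by decide)
  have h03 := hu 0 3 (by decide)
  have h12 := hu 1 2 (by decide)
  have h13 := hu 1 3 (by decide)
  simp only [Joined, HalfJoined, or_false] at h01 h23 h02 h03 h12 h13
  rw [← h02, ← h03, ← h12, ← h13] at h23
  exact Finset.not_disjoint_iff.2 ⟨_, h01, h23⟩

/-- If the inputs intersect, then the network has an induced copy of the pattern. -/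
theorem isIndContained_network (hcol : ∀ v w c, H.Adj v w → col v = some c → col w ≠ some c)
    (h : ¬ Disjoint x y) : H.IsIndContained (network H col R x y) := by
  obtain ⟨⟨⟨i, j⟩, ⟨k, l⟩⟩, hx, hy⟩ := Finset.not_disjoint_iff.1 h
  let pos : Option (Fin 4) → Fin q × Fin q
    | none => 0
    | some 0 => (i, j)
    | some 1 => (k, l)
    | some 2 => (i, k)
    | some 3 => (j, l)
  have hpos : ∀ c d, (∀ e, c = some e → d ≠ some e) → Joined x y c (pos c) d (pos d) := by
    rintro (_ | c) (_ | d) hcd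
    · simp [Joined, pos]
    · simp [Joined, pos]
    · simp [Joined, pos]
    · have : c ≠ d := fun h => hcd c rfl (by rw [h])
      fin_cases c <;> fin_cases d <;>
        first | exact absurd rfl this | simp [Joined, HalfJoined, pos, hx, hy]
  exact ⟨⟨⟨fun w => .inl (w, pos (col w)), fun v w hvw => (Prod.ext_iff.1 (Sum.inl.inj hvw)).1⟩,
    fun {v w} => ⟨fun h => h.1, fun h => ⟨h, hpos _ _ fun e => hcol v w e h⟩⟩⟩⟩

/-- If the network contains the pattern, and the colored nodes are a member of a clique cover of
minimum size, then the inputs intersect. -/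
theorem not_disjoint_of_isContained {𝒞 : Finset (Set W)} (h𝒞 : CliqueCover H 𝒞)
    (hmin : ∀ 𝒟, CliqueCover H 𝒟 → 𝒞.card ≤ 𝒟.card)
    (hmem : {w | (col w).isSome} ∈ 𝒞) (h : H.IsContained (network H col R x y)) :
    ¬ Disjoint x y := by
  classical
  obtain ⟨φ⟩ := h
  intro hdis
  let pull : Set W → Set W := fun C => {w | ∃ p, φ w = .inl p ∧ p.1 ∈ C}
  suffices hcover : CliqueCover H ((𝒞.erase {w | (col w).isSome}).image pull) by
    have h1 := hmin _ hcover
    have h2 : ((𝒞.erase {w | (col w).isSome}).image pull).card ≤ _ := Finset.card_image_le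
    rw [Finset.card_erase_of_mem hmem] at h2
    have := Finset.card_pos.2 ⟨_, hmem⟩
    omega
  refine ⟨fun D hD => ?_, fun s hs => ?_⟩
  · obtain ⟨C, hC, rfl⟩ := Finset.mem_image.1 hD
    have hsel : ∀ w : pull C, ∃ p, φ w.1 = .inl p ∧ p.1 ∈ C := fun w => w.2
    choose p hp hpC using hsel
    refine (h𝒞.1 C (Finset.mem_of_mem_erase hC)).of_hom
      ⟨fun w => ⟨(p w).1, hpC w⟩, fun {v w} hvw => ?_⟩
    have := φ.toHom.map_adj (show H.Adj v.1 w.1 from hvw)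
    change NodeAdj H col x y (φ v.1) (φ w.1) at this
    rw [hp, hp] at this
    exact this.1
  · have hinl : ∀ w ∈ s, ∃ p, φ w = .inl p := by
      intro w hw
      have hc : 1 < (s.erase w).card := by
        rw [Finset.card_erase_of_mem hw, hs.card_eq]; norm_num
      obtain ⟨a, ha, b, hb, hab⟩ := Finset.one_lt_card.1 hc
      rw [Finset.mem_erase] at ha hb
      exact exists_eq_inl_of_triangle (φ.toHom.map_adj (hs.isClique hw ha.2 ha.1.symm))
        (φ.toHom.map_adj (hs.isClique hw hb.2 hb.1.symm))
        (φ.toHom.map_adj (hs.isClique ha.2 hb.2 hab))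
    have : Nonempty (W × (Fin q × Fin q)) := by
      obtain ⟨w, hw⟩ := Finset.card_pos.1 (by rw [hs.card_eq]; norm_num : 0 < s.card)
      exact ⟨(w, 0)⟩
    choose! p hp using hinl
    have hadj : ∀ v ∈ s, ∀ w ∈ s, v ≠ w →
        H.Adj (p v).1 (p w).1 ∧ Joined x y (col (p v).1) (p v).2 (col (p w).1) (p w).2 := by
      intro v hv w hw hvw
      have := φ.toHom.map_adj (hs.isClique hv hw hvw)
      change NodeAdj H col x y (φ v) (φ w) at this
      rwa [hp v hv, hp w hw] at this
    have hinj : Set.InjOn (fun w => (p w).1) s := by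
      intro v hv w hw hvw
      by_contra hne
      exact (hadj v hv w hw hne).1.ne hvw
    have hs' : H.IsNClique 4 (s.image fun w => (p w).1) := by
      refine ⟨?_, by rw [Finset.card_image_of_injOn hinj, hs.card_eq]⟩
      intro a ha b hb hab
      obtain ⟨v, hv, rfl⟩ := Finset.mem_image.1 (Finset.mem_coe.1 ha)
      obtain ⟨w, hw, rfl⟩ := Finset.mem_image.1 (Finset.mem_coe.1 hb)
      exact (hadj v hv w hw fun h => hab (by rw [h])).1
    obtain ⟨C, hC, hsC⟩ := h𝒞.2 _ hs'
    have hsC' : ∀ w ∈ s, (p w).1 ∈ C := fun w hw =>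
      hsC (Finset.mem_coe.2 (Finset.mem_image_of_mem _ hw))
    by_cases hCe : C = {w | (col w).isSome}
    · exfalso
      have hsome : ∀ w ∈ s, ∃ c, col (p w).1 = some c := fun w hw =>
        Option.isSome_iff_exists.1 (by have := hsC' w hw; rwa [hCe] at this)
      choose! c hc using hsome
      have hcinj : Set.InjOn c s := by
        intro v hv w hw hvw
        by_contra hne
        have := (hadj v hv w hw hne).2
        rw [hc v hv, hc w hw, hvw] at this
        exact not_joined_self x y _ _ _ this
      have hsurj : s.image c = Finset.univ := by
        rw [← Finset.card_eq_iff_eq_univ, Finset.card_image_of_injOn hcinj, hs.card_eq,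
          Fintype.card_fin]
      have hex : ∀ d : Fin 4, ∃ w ∈ s, c w = d := fun d =>
        Finset.mem_image.1 (hsurj ▸ Finset.mem_univ d)
      choose g hg hgc using hex
      refine not_disjoint_of_joined (fun d => (p (g d)).2) (fun d e hde => ?_) hdis
      have := (hadj (g d) (hg d) (g e) (hg e) fun h => hde (by rw [← hgc d, h, hgc e])).2
      rwa [hc _ (hg d), hc _ (hg e), hgc, hgc] at this
    · exact ⟨pull C, Finset.mem_image_of_mem _ (Finset.mem_erase.2 ⟨hCe, hC⟩), fun w hw =>
        ⟨p w, hp w hw, hsC' w hw⟩⟩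

end Network

section Cut

variable {q : ℕ} [NeZero q]

/-- The colors of the nodes of Bob. -/
def BobColor (c : Option (Fin 4)) : Prop := c = some 2 ∨ c = some 3

theorem Joined.alice {c d : Option (Fin 4)} (hc : ¬ BobColor c) (hd : ¬ BobColor d)
    {x y : Finset (Element q)} {u v : Fin q × Fin q} (h : Joined x y c u d v)
    (y' : Finset (Element q)) : Joined x y' c u d v := by
  rcases c with _ | c <;> rcases d with _ | d
  · exact h
  · exact h
  · exact h
  · fin_cases c <;> fin_cases d <;> simp_all [Joined, HalfJoined, BobColor]

theorem Joined.bob {c d : Option (Fin 4)} (hc : BobColor c) (hd : BobColor d)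
    {x y : Finset (Element q)} {u v : Fin q × Fin q} (h : Joined x y c u d v)
    (x' : Finset (Element q)) : Joined x' y c u d v := by
  rcases hc with rfl | rfl <;> rcases hd with rfl | rfl <;> exact h

theorem Joined.cut {c d : Option (Fin 4)} (hc : BobColor c) (hd : ¬ BobColor d)
    {x y : Finset (Element q)} {u v : Fin q × Fin q} (h : Joined x y c u d v)
    (x' y' : Finset (Element q)) : Joined x' y' c u d v := by
  rcases hc with rfl | rfl <;> rcases d with _ | d
  any_goals exact h
  all_goals fin_cases d <;> simp_all [Joined, HalfJoined, BobColor]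

/-- The positions of the neighbours, across the cut, of the copy of a colored node at position `u`. -/
def crossing : Option (Fin 4) → Option (Fin 4) → Fin q × Fin q → Fin q → Fin q × Fin q
  | some 2, some 0, u, s => (u.1, s)
  | some 2, some 1, u, s => (u.2, s)
  | some 3, some 0, u, s => (s, u.1)
  | some 3, some 1, u, s => (s, u.2)
  | _, _, _, _ => 0

theorem Joined.exists_crossing {c d : Option (Fin 4)} (hc : BobColor c) (hd : ¬ BobColor d)
    {x y : Finset (Element q)} {u v : Fin q × Fin q} (h : Joined x y c u d v) :
    ∃ s, v = crossing c d u s := by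
  rcases hc with rfl | rfl <;> rcases d with _ | d
  · exact ⟨0, h⟩
  · fin_cases d <;> simp_all [Joined, HalfJoined, BobColor, crossing, Prod.ext_iff]
  · exact ⟨0, h⟩
  · fin_cases d <;> simp_all [Joined, HalfJoined, BobColor, crossing, Prod.ext_iff]

variable {W : Type*} {H : SimpleGraph W} {col : W → Option (Fin 4)} {R : Type*}
  {x y : Finset (Element q)}

/-- The nodes of Bob. -/
def BobNode (col : W → Option (Fin 4)) : Node W q R → Prop
  | .inl a => BobColor (col a.1)
  | _ => False

/-- The possible neighbours of a node of Bob across the cut. -/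
def cutNeighbor (col : W → Option (Fin 4)) (a : W × (Fin q × Fin q)) :
    Option (W × Fin q) → Node W q R
  | none => .inr (.inl a)
  | some (w, s) => .inl (w, crossing (col a.1) (col w) a.2 s)

theorem exists_eq_cutNeighbor {u v : Node W q R} (hu : BobNode col u) (hv : ¬ BobNode col v)
    (h : NodeAdj H col x y u v) : ∃ a o, u = .inl a ∧ v = cutNeighbor col a o := by
  rcases u with a | a | a
  · rcases v with b | b | b
    · obtain ⟨s, hs⟩ := h.2.exists_crossing hu hv
      exact ⟨a, some (b.1, s), rfl, by rw [cutNeighbor, ← hs]⟩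
    · exact ⟨a, none, rfl, by rw [cutNeighbor, show a = b from h]⟩
    · exact h.elim
  · exact hu.elim
  · exact hu.elim

/-- The two ends of a possible edge across the cut; the Boolean value is the direction. -/
def cutEnd (col : W → Option (Fin 4)) (e : Bool × (W × (Fin q × Fin q)) × Option (W × Fin q)) :
    Node W q R :=
  if e.1 then .inl e.2.1 else cutNeighbor col e.2.1 e.2.2

theorem nodeAdj_cut {u v : Node W q R} (hu : BobNode col u) (hv : ¬ BobNode col v)
    (h : NodeAdj H col x y u v) (x' y' : Finset (Element q)) : NodeAdj H col x' y' u v := by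
  rcases u with a | a | a
  · rcases v with b | b | b
    · exact ⟨h.1, h.2.cut hu hv x' y'⟩
    · exact h
    · exact h
  · exact hu.elim
  · exact hu.elim

/-- The networks on the nodes `0, …, n - 1` are a family for a two-party simulation. -/
theorem twoParty_network {n : ℕ} (f : Fin n ≃ Node W q R) :
    TwoParty (fun x y => (network H col R x y).comap f) (fun v => BobNode col (f v))
      (fun e => f.symm (cutEnd col e)) (fun e => f.symm (cutEnd col (!e.1, e.2))) where
  alice_adj u v hu hv x y y' h := by
    change NodeAdj H col x y (f u) (f v) at h
    change NodeAdj H col x y' (f u) (f v)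
    generalize f u = a at *
    generalize f v = b at *
    rcases a with a | a | a <;> rcases b with b | b | b
    · exact ⟨h.1, h.2.alice hu hv y'⟩
    all_goals exact h
  bob_adj u v hu hv x x' y h := by
    change NodeAdj H col x y (f u) (f v) at h
    change NodeAdj H col x' y (f u) (f v)
    generalize f u = a at *
    generalize f v = b at *
    rcases a with a | a | a <;> rcases b with b | b | b
    · exact ⟨h.1, h.2.bob hu hv x'⟩
    all_goals exact h
  cut_adj u v huv x y x' y' h := by
    by_cases hu : BobNode col (f u)
    · exact nodeAdj_cut hu (by tauto) h x' y'
    · have h' : NodeAdj H col x y (f v) (f u) := (network H col R x y).symm.symm _ _ h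
      exact (network H col R x' y').symm.symm _ _ (nodeAdj_cut (by tauto) hu h' x' y')
  cut_cover u v huv x y h := by
    by_cases hu : BobNode col (f u)
    · obtain ⟨a, o, h1, h2⟩ := exists_eq_cutNeighbor hu (by tauto) h
      exact ⟨(true, a, o), by simp [cutEnd, ← h1], by simp [cutEnd, ← h2]⟩
    · have h' : NodeAdj H col x y (f v) (f u) := (network H col R x y).symm.symm _ _ h
      obtain ⟨a, o, h1, h2⟩ := exists_eq_cutNeighbor (by tauto) hu h'
      exact ⟨(false, a, o), by simp [cutEnd, ← h2], by simp [cutEnd, ← h1]⟩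

end Cut

section LowerBound

/-- An algorithm which decides whether two sets intersect, in a family of networks for a two-party
simulation, has to send many bits over the cut. -/
theorem Algorithm.DecidesIn.le_communication {n B T m : ℕ} {A : Algorithm n B}
    {P : SimpleGraph (Fin n) → Prop} (hA : A.DecidesIn P T)
    {U : Type*} [Fintype U] (hU : Fintype.card U = 2 * m + 1)
    {G : Finset U → Finset U → SimpleGraph (Fin n)} (hG : ∀ x y, (G x y).Connected)
    (hP : ∀ x y, P (G x y) ↔ ¬ Disjoint x y)
    {bob : Fin n → Prop} {E : Type*} [Fintype E] {src tgt : E → Fin n}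
    (h : TwoParty G bob src tgt) :
    1 / 60 ≤ (2 : ℝ) ^ ((B + 1) * Fintype.card E * T) * Real.exp (-((m + 1 : ℝ) / 10000)) := by
  classical
  let _ := A.seedSpace
  have := A.law_prob
  obtain ⟨hM, hcard⟩ := card_message_le B
  have hmeas : ∀ x y, MeasurableSet {seed | ¬ A.Accepts (G x y) T seed} := by
    intro x y
    have hm := (hA (G x y) (hG x y)).1
    by_cases hp : P (G x y)
    · simp only [hp, iff_true] at hm
      exact hm.compl
    · simpa only [hp, iff_false] using hm
  have key := Disjointness.card_label_ge hU A.law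
    (fun x y => {seed | ¬ A.Accepts (G x y) T seed}) hmeas (fun x y hxy => ?_) (fun x y hxy => ?_)
    (fun seed x y => A.transcript G src tgt T seed x y)
    (fun seed x y x' y' h1 h2 hτ => A.transcript_mixed h h1 h2 hτ)
  · refine key.trans (mul_le_mul_of_nonneg_right ?_ (Real.exp_pos _).le)
    rw [Fintype.card_fun, Fintype.card_fun, Fintype.card_fin]
    push_cast
    rw [pow_mul, pow_mul]
    gcongr
    exact_mod_cast hcard
  · have hp : ¬ P (G x y) := by rw [hP]; exact not_not.2 hxy
    simpa only [hp, iff_false] using (hA (G x y) (hG x y)).2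
  · have hp : P (G x y) := (hP x y).2 hxy
    obtain ⟨hm, hge⟩ := hA (G x y) (hG x y)
    simp only [hp, iff_true] at hm hge
    have := probReal_compl_eq_one_sub (μ := A.law) hm
    change A.law.real {seed | A.Accepts (G x y) T seed}ᶜ ≤ 1 / 3
    linarith

theorem decides_lower_bound {W : Type*} [Fintype W] {H : SimpleGraph W} (hH : ¬ H.CliqueFree 4)
    {n B T p : ℕ} (hn : 2 * (Fintype.card W * (2 * p + 1) ^ 2) < n) (A : Algorithm n B)
    (hA : A.SolvesDetection H T ∨ A.SolvesInducedDetection H T) :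
    1 / 60 ≤ (2 : ℝ) ^ ((B + 1) * (4 * Fintype.card W ^ 2 * (2 * p + 1) ^ 3) * T) *
      Real.exp (-((2 * p + 1 : ℝ) ^ 4 / 20000)) := by
  classical
  obtain ⟨𝒞, h𝒞, hmin, C, hC⟩ := exists_minimum_cliqueCover hH
  obtain ⟨c⟩ := h𝒞.1 C hC
  let col : W → Option (Fin 4) := fun w => if hw : w ∈ C then some (c ⟨w, hw⟩) else none
  have hcolC : {w | (col w).isSome} = C := by
    ext w
    by_cases hw : w ∈ C <;> simp [col, hw]
  have hcol : ∀ v w d, H.Adj v w → col v = some d → col w ≠ some d := by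
    intro v w d hvw hv hw
    by_cases hvC : v ∈ C
    · by_cases hwC : w ∈ C
      · simp only [col, hvC, hwC, dif_pos, Option.some.injEq] at hv hw
        exact c.valid (v := ⟨v, hvC⟩) (w := ⟨w, hwC⟩) hvw (hv.trans hw.symm)
      · simp [col, hwC] at hw
    · simp [col, hvC] at hv
  set q := 2 * p + 1 with hq
  have hW : Nonempty W := by
    by_contra hempty
    rw [not_nonempty_iff] at hempty
    exact hH (SimpleGraph.cliqueFree_of_card_lt (by simp))
  have hWpos : 0 < Fintype.card W := Fintype.card_pos
  let R := Fin (n - 2 * (Fintype.card W * q ^ 2))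
  have hR : Nonempty R := ⟨⟨0, by omega⟩⟩
  have f : Fin n ≃ Node W q R := by
    refine Fintype.equivOfCardEq ?_
    simp only [Fintype.card_fin, Fintype.card_sum, Fintype.card_prod, R, ← sq]
    omega
  have hU : Fintype.card (Element q) = 2 * (8 * p ^ 4 + 16 * p ^ 3 + 12 * p ^ 2 + 4 * p) + 1 := by
    simp only [Fintype.card_prod, Fintype.card_fin, hq]
    ring
  let G : Finset (Element q) → Finset (Element q) → SimpleGraph (Fin n) :=
    fun x y => (network H col R x y).comap f
  have iso : ∀ x y, G x y ≃g network H col R x y := fun x y => SimpleGraph.Iso.comap f _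
  have hG : ∀ x y, (G x y).Connected := fun x y => (iso x y).connected_iff.2 network_connected
  have hind : ∀ x y, ¬ Disjoint x y → H.IsIndContained (G x y) := fun x y hxy =>
    (isIndContained_network hcol hxy).trans ⟨(iso x y).symm.toEmbedding⟩
  have hcont : ∀ x y, H.IsContained (G x y) → ¬ Disjoint x y := fun x y h =>
    not_disjoint_of_isContained h𝒞 hmin (hcolC ▸ hC)
      (h.trans ⟨(iso x y).toEmbedding.toCopy⟩)
  have key : 1 / 60 ≤ (2 : ℝ) ^ ((B + 1) * Fintype.card
      (Bool × (W × (Fin q × Fin q)) × Option (W × Fin q)) * T) *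
      Real.exp (-(((8 * p ^ 4 + 16 * p ^ 3 + 12 * p ^ 2 + 4 * p : ℕ) + 1 : ℝ) / 10000)) := by
    rcases hA with hA | hA
    · exact hA.le_communication hU hG
        (fun x y => ⟨hcont x y, fun h => (hind x y h).isContained⟩) (twoParty_network f)
    · exact hA.le_communication hU hG
        (fun x y => ⟨fun h => hcont x y h.isContained, hind x y⟩) (twoParty_network f)
  refine key.trans (mul_le_mul ?_ ?_ (Real.exp_pos _).le (by positivity))
  · refine pow_le_pow_right₀ (by norm_num) ?_
    gcongr
    simp only [Fintype.card_prod, Fintype.card_option, Fintype.card_fin, Fintype.card_bool]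
    have : 1 ≤ Fintype.card W * q := Nat.mul_pos hWpos (by omega)
    calc 2 * (Fintype.card W * (q * q) * (Fintype.card W * q + 1))
        ≤ 2 * (Fintype.card W * (q * q) * (Fintype.card W * q + Fintype.card W * q)) := by gcongr
      _ = _ := by ring
  · refine Real.exp_le_exp.2 (neg_le_neg ?_)
    push_cast
    have hp : (0 : ℝ) ≤ p := Nat.cast_nonneg p
    nlinarith

end LowerBound

theorem rounds_lower_bound {w n B T p : ℕ} {b : ℝ} (hw : 0 < w) (hp : 40 ≤ p)
    (hnp : n < 32 * w * (p + 1) ^ 2) (hn : 3 ≤ n) (hB : (B : ℝ) ≤ b * Real.log n)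
    (h : 1 / 60 ≤ (2 : ℝ) ^ ((B + 1) * (4 * w ^ 2 * (2 * p + 1) ^ 3) * T) *
      Real.exp (-((2 * p + 1 : ℝ) ^ 4 / 20000))) :
    1 / (Real.sqrt (32 * w) * (160000 * w ^ 2 * (|b| + 1))) *
      ((n : ℝ) ^ (1 / 2 : ℝ) / Real.log n) ≤ T := by
  have hw' : (1 : ℝ) ≤ w := by exact_mod_cast hw
  have hp' : (40 : ℝ) ≤ p := by exact_mod_cast hp
  have hlog : 1 ≤ Real.log n := by
    rw [Real.le_log_iff_exp_le (by positivity)]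
    have h3 : (3 : ℝ) ≤ n := by exact_mod_cast hn
    linarith [Real.exp_one_lt_d9]
  set Q : ℝ := 2 * p + 1 with hQ
  have hQ40 : 40 ≤ Q := by linarith
  have hbits : Q ≤ 160000 * w ^ 2 * ((B + 1) * T) := by
    have h2 : Real.exp (Q ^ 4 / 20000) ≤
        60 * Real.exp ((B + 1) * (4 * w ^ 2 * Q ^ 3) * T) := by
      have h3 : (2 : ℝ) ^ ((B + 1) * (4 * w ^ 2 * (2 * p + 1) ^ 3) * T) ≤
          Real.exp ((B + 1) * (4 * w ^ 2 * Q ^ 3) * T) := by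
        calc _ ≤ Real.exp 1 ^ ((B + 1) * (4 * w ^ 2 * (2 * p + 1) ^ 3) * T) := by
              gcongr; linarith [Real.add_one_le_exp 1]
          _ = _ := by rw [← Real.exp_nat_mul]; push_cast; rw [← hQ]; ring_nf
      have h4 := h.trans (mul_le_mul_of_nonneg_right h3 (Real.exp_pos _).le)
      rw [Real.exp_neg, ← div_eq_mul_inv, le_div_iff₀ (Real.exp_pos _)] at h4
      linarith
    have h60 : (60 : ℝ) ≤ Real.exp 59 := by linarith [Real.add_one_le_exp 59]
    have h5 : Real.exp (Q ^ 4 / 20000) ≤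
        Real.exp (59 + (B + 1) * (4 * w ^ 2 * Q ^ 3) * T) := by
      rw [Real.exp_add]
      exact h2.trans (mul_le_mul_of_nonneg_right h60 (Real.exp_pos _).le)
    rw [Real.exp_le_exp] at h5
    have h6 : (40 : ℝ) ^ 4 ≤ Q ^ 4 := by gcongr
    have h7 : Q ^ 3 * Q ≤ Q ^ 3 * (160000 * w ^ 2 * ((B + 1) * T)) := by linarith
    exact le_of_mul_le_mul_left h7 (by positivity)
  have hsqrt : (n : ℝ) ^ (1 / 2 : ℝ) ≤ Real.sqrt (32 * w) * Q := by
    rw [← Real.sqrt_eq_rpow]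
    refine Real.sqrt_le_iff.2 ⟨by positivity, ?_⟩
    rw [mul_pow, Real.sq_sqrt (by positivity)]
    have h8 : (n : ℝ) ≤ 32 * w * (p + 1) ^ 2 := by exact_mod_cast hnp.le
    refine h8.trans ?_
    gcongr
    linarith
  have hB1 : (B + 1 : ℝ) ≤ (|b| + 1) * Real.log n := by
    have := mul_le_mul_of_nonneg_right (le_abs_self b) (by linarith : 0 ≤ Real.log n)
    linarith
  rw [div_mul_div_comm, one_mul, div_le_iff₀ (by positivity)]
  calc (n : ℝ) ^ (1 / 2 : ℝ) ≤ Real.sqrt (32 * w) * Q := hsqrt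
    _ ≤ Real.sqrt (32 * w) * (160000 * w ^ 2 * (((|b| + 1) * Real.log n) * T)) := by
        refine mul_le_mul_of_nonneg_left (hbits.trans ?_) (Real.sqrt_nonneg _)
        gcongr
    _ = _ := by ring

end Congest

theorem mainTheorem3 {W : Type*} [Finite W] (H : SimpleGraph W) (hH : ¬ H.CliqueFree 4) (b : ℝ) :
    ∃ c : ℝ, 0 < c ∧ ∃ n₀ : ℕ, ∀ n : ℕ, n₀ ≤ n →
      ∀ B : ℕ, (B : ℝ) ≤ b * Real.log n →
        ∀ (A : Congest.Algorithm n B) (T : ℕ),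
          (A.SolvesDetection H T ∨ A.SolvesInducedDetection H T) →
            c * ((n : ℝ) ^ (1 / 2 : ℝ) / Real.log n) ≤ T := by
  have := Fintype.ofFinite W
  have hw : 0 < Fintype.card W := by
    by_contra h0
    exact hH (SimpleGraph.cliqueFree_of_card_lt (by omega))
  have hw' : (0 : ℝ) < Fintype.card W := by exact_mod_cast hw
  set w := Fintype.card W
  refine ⟨1 / (Real.sqrt (32 * w) * (160000 * w ^ 2 * (|b| + 1))), by positivity, 60000 * w,
    fun n hn B hB A T hA => ?_⟩
  obtain ⟨p, hp1, hp2⟩ : ∃ p, p * p ≤ n / (32 * w) ∧ n / (32 * w) < (p + 1) * (p + 1) :=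
    ⟨_, Nat.sqrt_le _, Nat.lt_succ_sqrt _⟩
  have hle : p * p * (32 * w) ≤ n := (Nat.le_div_iff_mul_le (by positivity)).1 hp1
  have hlt : n < (p + 1) * (p + 1) * (32 * w) := (Nat.div_lt_iff_lt_mul (by positivity)).1 hp2
  have hp : 40 ≤ p := by
    by_contra! h
    have : (p + 1) * (p + 1) * (32 * w) ≤ 40 * 40 * (32 * w) := by gcongr <;> omega
    omega
  refine Congest.rounds_lower_bound hw hp (by linarith) (by omega) hB
    (Congest.decides_lower_bound hH ?_ A hA)
  have hpp : 40 * 40 ≤ p * p := Nat.mul_le_mul hp hp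
  have : 2 * (2 * p + 1) ^ 2 < p * p * 32 := by nlinarith
  calc 2 * (w * (2 * p + 1) ^ 2) = 2 * (2 * p + 1) ^ 2 * w := by ring
    _ < p * p * 32 * w := Nat.mul_lt_mul_of_pos_right this hw
    _ ≤ n := by linarith
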